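/- Let $K$ be a field of characteristic $0$; all vector spaces and Lie algebras are over $K$, of arbitrary dimension. For vector spaces $E,F$ and $m\ge 0$, let $F[E]_m$ be the vector space of maps $f:E\to F$ of the form $f(x)=u(x,\dots,x)$ with $u:E^m\to F$ an $m$-linear map (one says that $u$ determines $f$), and let $F[[E]]=\prod_{m\ge 0}F[E]_m$. For a vector space $X$ put $S(X)=X[[X]]$. If $\xi\in X[X]_r$ and $f\in F[X]_m$ is determined by $u$, let $$(\xi f)(x)=\sum_{i=1}^m u(x,\dots,x,\xi(x),x,\dots,x)\qquad(\xi(x)\text{ in the }i\text{-th place});$$ this does not depend on $u$, and $\xi f\in F[X]_{r+m-1}$ (with $\xi f=0$ if $m=0$). For $\xi=(\xi_r)\in S(X)$ and $f=(f_m)\in F[[X]]$ let $\xi f\in F[[X]]$ be the series with components $(\xi f)_s=\sum_{r+m-1=s}\xi_r f_m$, $s\ge 0$. With the bracket $[\xi,\eta]=\xi\eta-\eta\xi$, $S(X)$ is a Lie algebra. A formal (right) action of a Lie algebra $A$ on $X$ is a homomorphism of Lie algebras $A\to S(X)$. Define $t_n\in K$ by $\displaystyle\sum_{n\ge0}t_nT^n=\frac{T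 e^T}{e^T-1}$ in $K[[T]]$. Let $B$ be a Lie algebra over $K$. For $b\in B$ let $\mathrm d_b=(\mathrm d_{b,n})_{n\ge 0}\in S(B)$ be the formal series with components $$\mathrm d_{b,n}(y)=t_n(\operatorname{ad}y)^n(b),\qquad (\operatorname{ad}y)(b)=[y,b].$$ **Theorem.** For every Lie algebra $B$ over $K$, the map $b\mapsto \mathrm d_b$, $B\to S(B)$, is a homomorphism of Lie algebras; that is, it is a formal (right) action of $B$ on itself. -/

import Mathlib

/-! Formal power series with variables and coefficients in vector spaces, the Lie algebra `S(X)`,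
formal actions of Lie algebras and the fundamental action. -/

namespace FormalAct

section HomogeneousPolynomials

variable (K : Type*) [Field K] (E F : Type*) [AddCommGroup E] [Module K E]
  [AddCommGroup F] [Module K F]

/-- The space `F[E]_m` of homogeneous polynomials of degree `m` with variables in `E` and
coefficients in `F`: the maps `x ↦ u (x, …, x)` with `u : E ^ m → F` multilinear. -/
def HomPoly (m : ℕ) : Submodule K (E → F) where
  carrier := {f | ∃ u : MultilinearMap K (fun _ : Fin m => E) F, ∀ x, f x = u (fun _ => x)}
  add_mem' := by
    rintro f g ⟨u, hu⟩ ⟨v, hv⟩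
    exact ⟨u + v, fun x => by simp [hu, hv]⟩
  zero_mem' := ⟨0, fun x => by simp⟩
  smul_mem' := by
    rintro c f ⟨u, hu⟩
    exact ⟨c • u, fun x => by simp [hu]⟩

/-- The space `F[[E]]` of formal series with variables in `E` and coefficients in `F`. -/
def FormalSeries : Type _ := ∀ m : ℕ, HomPoly K E F m

instance : AddCommGroup (FormalSeries K E F) :=
  inferInstanceAs (AddCommGroup (∀ m : ℕ, HomPoly K E F m))

instance : Module K (FormalSeries K E F) :=
  inferInstanceAs (Module K (∀ m : ℕ, HomPoly K E F m))

end HomogeneousPolynomials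

section Derivation

variable {K : Type*} [Field K] {E F : Type*} [AddCommGroup E] [Module K E]
  [AddCommGroup F] [Module K F]

/-- For a homogeneous polynomial `f` determined by a multilinear map `u`, the sum of the
`u (x, …, v, …, x)` with `v` at the `i`-th place, over all places `i`. It does not depend on the
choice of `u` when `K` has characteristic zero, see `polar_eq`. -/
noncomputable def polar {m : ℕ} (f : HomPoly K E F m) (x v : E) : F :=
  ∑ i : Fin m, f.2.choose (Function.update (fun _ => x) i v)

/-! ### Expansions along lines -/

variable (K F) in
/-- Polynomial functions `K → F`. -/
def PolyFun : Submodule K (K → F) :=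
  Submodule.span K (Set.range fun (p : ℕ × F) (s : K) => s ^ p.1 • p.2)

theorem PolyFun.mono (n : ℕ) (a : F) : (fun s : K => s ^ n • a) ∈ PolyFun K F :=
  Submodule.subset_span ⟨(n, a), rfl⟩

theorem PolyFun.const (a : F) : (fun _ : K => a) ∈ PolyFun K F := by
  simpa using PolyFun.mono (K := K) 0 a

theorem PolyFun.bilin {G H : Type*} [AddCommGroup G] [Module K G] [AddCommGroup H] [Module K H]
    (B : F →ₗ[K] G →ₗ[K] H) {R : K → F} {Q : K → G} (hR : R ∈ PolyFun K F)
    (hQ : Q ∈ PolyFun K G) : (fun s => B (R s) (Q s)) ∈ PolyFun K H := by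
  refine Submodule.span_induction ?_ ?_ ?_ ?_ hR
  · rintro _ ⟨⟨n, a⟩, rfl⟩
    refine Submodule.span_induction ?_ ?_ ?_ ?_ hQ
    · rintro _ ⟨⟨k, b⟩, rfl⟩
      have h := PolyFun.mono (K := K) (n + k) (B a b)
      convert h using 1
      ext s
      simp only [map_smul, LinearMap.smul_apply, pow_add, mul_smul]
      rw [smul_comm]
    · have h := (PolyFun K H).zero_mem
      convert h using 1
      ext s
      simp
    · intro f g _ _ hf hg
      have h := (PolyFun K H).add_mem hf hg
      convert h using 1
      ext s
      simp
    · intro c f _ hf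
      have h := (PolyFun K H).smul_mem c hf
      convert h using 1
      ext s
      simp [smul_comm c]
  · have h := (PolyFun K H).zero_mem
    convert h using 1
    ext s
    simp
  · intro f g _ _ hf hg
    have h := (PolyFun K H).add_mem hf hg
    convert h using 1
    ext s
    simp
  · intro c f _ hf
    have h := (PolyFun K H).smul_mem c hf
    convert h using 1
    ext s
    simp

theorem PolyFun.pow_smul (n : ℕ) {R : K → F} (hR : R ∈ PolyFun K F) :
    (fun s => s ^ n • R s) ∈ PolyFun K F := by
  simpa using PolyFun.bilin (LinearMap.lsmul K F) (PolyFun.mono (K := K) n (1 : K)) hR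

theorem PolyFun.dual {R : K → F} (hR : R ∈ PolyFun K F) (φ : Module.Dual K F) :
    ∃ p : Polynomial K, ∀ s, φ (R s) = p.eval s := by
  refine Submodule.span_induction ?_ ?_ ?_ ?_ hR
  · rintro _ ⟨⟨n, a⟩, rfl⟩
    exact ⟨Polynomial.C (φ a) * Polynomial.X ^ n, fun s => by
      simp only [map_smul, smul_eq_mul, Polynomial.eval_mul, Polynomial.eval_C, Polynomial.eval_pow,
        Polynomial.eval_X, mul_comm]⟩
  · exact ⟨0, by simp⟩
  · rintro f g _ _ ⟨p, hp⟩ ⟨q, hq⟩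
    exact ⟨p + q, fun s => by simp [hp, hq]⟩
  · rintro c f _ ⟨p, hp⟩
    exact ⟨Polynomial.C c * p, fun s => by simp [hp]⟩

variable (K) in
/-- `w` is the coefficient of `s` in the polynomial expansion of `f (x + s • v)`. -/
def HasDer (f : E → F) (x v : E) (w : F) : Prop :=
  ∃ R ∈ PolyFun K F, ∀ s : K, f (x + s • v) = f x + s • w + s ^ 2 • R s

theorem HasDer.unique [CharZero K] {f : E → F} {x v : E} {w w' : F} (h : HasDer K f x v w)
    (h' : HasDer K f x v w') : w = w' := by
  obtain ⟨R, hR, h⟩ := h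
  obtain ⟨R', hR', h'⟩ := h'
  rw [← sub_eq_zero, ← Module.forall_dual_apply_eq_zero_iff K]
  intro φ
  obtain ⟨p, hp⟩ := PolyFun.dual ((PolyFun K F).sub_mem hR hR') φ
  have key : Polynomial.X * Polynomial.C (φ (w - w')) + Polynomial.X ^ 2 * p = 0 := by
    refine Polynomial.funext fun s => ?_
    have h1 : s • (w - w') + s ^ 2 • (R - R') s = 0 := by
      have := (h s).symm.trans (h' s)
      simp only [Pi.sub_apply, smul_sub]
      rw [add_assoc, add_assoc, add_right_inj] at this
      rw [sub_add_sub_comm, this, sub_self]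
    have h2 := congrArg φ h1
    rw [map_add, map_smul, map_smul, hp, map_zero] at h2
    simpa using h2
  have := congrArg (fun q => Polynomial.coeff q 1) key
  simpa [pow_two, mul_assoc, Polynomial.coeff_X_mul, Polynomial.coeff_one] using this

theorem HasDer.sum {ι : Type*} (s : Finset ι) {f : ι → E → F} {x v : E} {w : ι → F}
    (h : ∀ i ∈ s, HasDer K (f i) x v (w i)) :
    HasDer K (fun y => ∑ i ∈ s, f i y) x v (∑ i ∈ s, w i) := by
  classical
  choose! R hR h using h
  refine ⟨fun t => ∑ i ∈ s, R i t, ?_, fun t => ?_⟩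
  · have := (PolyFun K F).sum_mem hR
    convert this using 1
    ext t
    simp
  · simp only [Finset.smul_sum, ← Finset.sum_add_distrib]
    exact Finset.sum_congr rfl fun i hi => h i hi t

theorem HasDer.bilin {G H : Type*} [AddCommGroup G] [Module K G] [AddCommGroup H] [Module K H]
    (B : F →ₗ[K] G →ₗ[K] H) {f : E → F} {g : E → G} {x v : E} {w : F} {z : G}
    (hf : HasDer K f x v w) (hg : HasDer K g x v z) :
    HasDer K (fun y => B (f y) (g y)) x v (B w (g x) + B (f x) z) := by
  obtain ⟨R, hR, hf⟩ := hf
  obtain ⟨Q, hQ, hg⟩ := hg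
  refine ⟨(fun _ => B w z) + (fun s => B (f x) (Q s)) + (fun s => B (R s) (g x))
    + (fun s => s ^ 1 • B w (Q s)) + (fun s => s ^ 1 • B (R s) z)
    + (fun s => s ^ 2 • B (R s) (Q s)), ?_, fun s => ?_⟩
  · exact add_mem (add_mem (add_mem (add_mem (add_mem (PolyFun.const _)
      (PolyFun.bilin B (PolyFun.const _) hQ)) (PolyFun.bilin B hR (PolyFun.const _)))
      (PolyFun.pow_smul 1 (PolyFun.bilin B (PolyFun.const _) hQ)))
      (PolyFun.pow_smul 1 (PolyFun.bilin B hR (PolyFun.const _))))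
      (PolyFun.pow_smul 2 (PolyFun.bilin B hR hQ))
  · simp only [hf, hg, map_add, map_smul, LinearMap.add_apply, LinearMap.smul_apply, Pi.add_apply]
    module

theorem multilinear_expand {ι : Type*} [Fintype ι] [DecidableEq ι]
    (u : MultilinearMap K (fun _ : ι => E) F) (a b : ι → E) :
    ∃ R ∈ PolyFun K F, ∀ s : K,
      u (a + s • b) = u a + s • u.linearDeriv a b + s ^ 2 • R s := by
  refine ⟨fun s => ∑ S : Finset ι with 2 ≤ S.card, s ^ (S.card - 2) • u (S.piecewise b a), ?_,
    fun s => ?_⟩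
  · have := (PolyFun K F).sum_mem (t := Finset.univ.filter fun S : Finset ι => 2 ≤ S.card)
      (f := fun S => fun s : K => s ^ (S.card - 2) • u (S.piecewise b a))
      (fun S _ => PolyFun.mono _ _)
    convert this using 1
    ext t
    simp
  · rw [u.map_add_eq_map_add_linearDeriv_add, map_smul, Finset.smul_sum]
    congr 1
    refine Finset.sum_congr rfl fun S hS => ?_
    have h2 : 2 ≤ S.card := by simpa using hS
    have h3 : S.piecewise (s • b) a = S.piecewise (fun i => s • S.piecewise b a i)
        (S.piecewise b a) := by
      ext i
      by_cases hi : i ∈ S <;> simp [hi]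
    rw [h3, u.map_piecewise_smul (fun _ => s), smul_smul, ← pow_add, Finset.prod_const,
      Nat.add_sub_cancel' h2]

theorem hasDer_of_determined {m : ℕ} {f : E → F} {u : MultilinearMap K (fun _ : Fin m => E) F}
    (hu : ∀ x, f x = u (fun _ => x)) (x v : E) :
    HasDer K f x v (∑ i : Fin m, u (Function.update (fun _ => x) i v)) := by
  obtain ⟨R, hR, h⟩ := multilinear_expand u (fun _ => x) (fun _ => v)
  refine ⟨R, hR, fun s => ?_⟩
  rw [u.linearDeriv_apply] at h
  rw [hu, hu]
  exact h s

theorem homPoly_hasDer {m : ℕ} (f : HomPoly K E F m) (x v : E) :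
    HasDer K (f : E → F) x v (polar f x v) :=
  hasDer_of_determined f.2.choose_spec x v

/-- The derivative of a homogeneous polynomial does not depend on the multilinear map that
determines it. -/
theorem polar_eq [CharZero K] {m : ℕ} (f : HomPoly K E F m)
    {u : MultilinearMap K (fun _ : Fin m => E) F} (hu : ∀ x, f.1 x = u (fun _ => x)) (x v : E) :
    polar f x v = ∑ i : Fin m, u (Function.update (fun _ => x) i v) :=
  (homPoly_hasDer f x v).unique (hasDer_of_determined hu x v)

theorem polar_zero (f : HomPoly K E F 0) (x v : E) : polar f x v = 0 := by
  simp [polar]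

/-- `polar` as a linear map in the direction. -/
noncomputable def polarLin {m : ℕ} (f : HomPoly K E F m) (x : E) : E →ₗ[K] F where
  toFun v := polar f x v
  map_add' v w := by simp [polar, Finset.sum_add_distrib]
  map_smul' c v := by simp [polar, Finset.smul_sum]

@[simp] theorem polarLin_apply {m : ℕ} (f : HomPoly K E F m) (x v : E) :
    polarLin f x v = polar f x v := rfl

theorem polarLin_mem {m : ℕ} (f : HomPoly K E F (m + 1)) :
    (polarLin f) ∈ HomPoly K E (E →ₗ[K] F) m := by
  refine ⟨∑ i : Fin (m + 1),
    (f.2.choose.domDomCongr (Equiv.swap i (Fin.last m))).curryRight, fun x => ?_⟩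
  ext v
  simp only [polarLin_apply, polar, sum_apply,
    LinearMap.sum_apply, MultilinearMap.curryRight_apply, MultilinearMap.domDomCongr_apply]
  refine Finset.sum_congr rfl fun i _ => ?_
  congr 1
  ext j
  by_cases hj : j = i
  · subst hj
    simp
  · rw [Function.update_of_ne hj]
    have : Equiv.swap i (Fin.last m) j ≠ Fin.last m := by
      intro h
      apply hj
      have := congrArg (Equiv.swap i (Fin.last m)) h
      simpa using this
    obtain ⟨k, hk⟩ := Fin.exists_castSucc_eq.mpr this
    rw [← hk, Fin.snoc_castSucc]

theorem bilin_mem {G H : Type*} [AddCommGroup G] [Module K G] [AddCommGroup H]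
    [Module K H] (B : F →ₗ[K] G →ₗ[K] H) {m n : ℕ} {f : E → F} {g : E → G}
    (hf : f ∈ HomPoly K E F m) (hg : g ∈ HomPoly K E G n) :
    (fun x => B (f x) (g x)) ∈ HomPoly K E H (m + n) := by
  obtain ⟨u, hu⟩ := hf
  obtain ⟨v, hv⟩ := hg
  refine ⟨((TensorProduct.lift B).compMultilinearMap (u.domCoprod v)).domDomCongr
    finSumFinEquiv, fun x => ?_⟩
  simp [hu, hv]

/-- For `ξ ∈ E[E]_r` and `f ∈ F[E]_m`, the map `x ↦ ∑ i, u (x, …, ξ x, …, x)` is a homogeneous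
polynomial of degree `r + m - 1` (and zero if `m = 0`). -/
theorem deriv_mem {r m s : ℕ} (h : r + m = s + 1) (ξ : HomPoly K E E r)
    (f : HomPoly K E F m) : (fun x => polar f x (ξ.1 x)) ∈ HomPoly K E F s := by
  cases m with
  | zero =>
    simp only [polar_zero]
    exact (HomPoly K E F s).zero_mem
  | succ k =>
    obtain rfl : k + r = s := by omega
    exact bilin_mem LinearMap.id (polarLin_mem f) ξ.2

/-- The second derivative. -/
noncomputable def polar₂ {m : ℕ} (f : HomPoly K E F (m + 1)) (x v w : E) : F :=
  polar (⟨(polarLin f), (polarLin_mem f)⟩ : HomPoly K E (E →ₗ[K] F) m) x v w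

theorem hasDer_polarLin {m : ℕ} (f : HomPoly K E F (m + 1)) (x v w : E) :
    HasDer K (fun y => polar f y w) x v (polar₂ f x v w) := by
  obtain ⟨R, hR, h⟩ :=
    homPoly_hasDer (⟨(polarLin f), (polarLin_mem f)⟩ : HomPoly K E (E →ₗ[K] F) m) x v
  refine ⟨fun s => R s w, ?_, fun s => ?_⟩
  · exact PolyFun.bilin LinearMap.id hR (PolyFun.const w)
  · exact congrArg (fun L : E →ₗ[K] F => L w) (h s)

theorem polar₂_symm [CharZero K] {m : ℕ} (f : HomPoly K E F (m + 1)) (x v w : E) :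
    polar₂ f x v w = polar₂ f x w v := by
  set u := f.2.choose with hu
  have key : ∀ v w : E, polar₂ f x v w = ∑ i, ∑ j, u (Function.update (Function.update
      (fun _ => x) i w) j (Function.update (fun _ => v) i 0 j)) := by
    intro v w
    refine (hasDer_polarLin f x v w).unique ?_
    refine HasDer.sum _ fun i _ => ?_
    obtain ⟨R, hR, h⟩ := multilinear_expand u (Function.update (fun _ => x) i w)
      (Function.update (fun _ => v) i 0)
    refine ⟨R, hR, fun s => ?_⟩
    rw [u.linearDeriv_apply] at h
    rw [← h s]
    refine congrArg u (funext fun j => ?_)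
    by_cases hj : j = i
    · subst hj; simp
    · simp [hj]
  rw [key, key, Finset.sum_comm]
  refine Finset.sum_congr rfl fun i _ => Finset.sum_congr rfl fun j _ => ?_
  by_cases hij : i = j
  · subst hij
    simp
  · rw [Function.update_of_ne hij, Function.update_of_ne (Ne.symm hij), Function.update_comm hij]

theorem hasDer_deriv {r m : ℕ} (ξ : HomPoly K E E r) (f : HomPoly K E F (m + 1))
    (x v : E) : HasDer K (fun y => polar f y (ξ.1 y)) x v
      (polar₂ f x v (ξ.1 x) + polar f x (polar ξ x v)) :=
  HasDer.bilin LinearMap.id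
    (homPoly_hasDer (⟨(polarLin f), (polarLin_mem f)⟩ : HomPoly K E (E →ₗ[K] F) m) x v) (homPoly_hasDer ξ x v)

theorem polar₂_zero (f : HomPoly K E F 1) (x v w : E) : polar₂ f x v w = 0 := by
  simp [polar₂, polar_zero]

theorem polar_add [CharZero K] {m : ℕ} (f g : HomPoly K E F m) (x v : E) :
    polar (f + g) x v = polar f x v + polar g x v := by
  rw [polar_eq (u := f.2.choose + g.2.choose)]
  · simp [polar, Finset.sum_add_distrib]
  · intro x
    have h1 := f.2.choose_spec x
    have h2 := g.2.choose_spec x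
    simp [← h1, ← h2]

theorem polar_smul [CharZero K] {m : ℕ} (c : K) (f : HomPoly K E F m) (x v : E) :
    polar (c • f) x v = c • polar f x v := by
  rw [polar_eq (u := c • f.2.choose)]
  · simp [polar, Finset.smul_sum]
  · intro x
    have h1 := f.2.choose_spec x
    simp [← h1]

/-- The derivative `ξ f` of a formal series `f` along `ξ ∈ E[[E]]`; its component of degree `s`
is the sum of the `ξ_r f_m` with `r + m - 1 = s`. -/
noncomputable def FormalSeries.deriv (ξ : FormalSeries K E E) (f : FormalSeries K E F) :
    FormalSeries K E F := fun s =>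
  ⟨fun x => ∑ p ∈ Finset.HasAntidiagonal.antidiagonal (s + 1), polar (f p.2) x ((ξ p.1).1 x), by
    have h := (HomPoly K E F s).sum_mem (t := Finset.HasAntidiagonal.antidiagonal (s + 1))
      (f := fun p x => polar (f p.2) x ((ξ p.1).1 x))
      (fun p hp => deriv_mem (Finset.HasAntidiagonal.mem_antidiagonal.mp hp) (ξ p.1) (f p.2))
    convert h using 1
    ext x
    simp⟩

theorem FormalSeries.ext {f g : FormalSeries K E F} (h : ∀ m x, (f m).1 x = (g m).1 x) : f = g :=
  funext fun m => Subtype.ext (funext (h m))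

theorem FormalSeries.deriv_apply (ξ : FormalSeries K E E) (f : FormalSeries K E F) (s : ℕ)
    (x : E) : (FormalSeries.deriv ξ f s).1 x =
      ∑ p ∈ Finset.HasAntidiagonal.antidiagonal s, polar (f (p.2 + 1)) x ((ξ p.1).1 x) := by
  change ∑ p ∈ Finset.HasAntidiagonal.antidiagonal (s + 1), polar (f p.2) x ((ξ p.1).1 x) = _
  rw [Finset.Nat.sum_antidiagonal_succ', polar_zero, zero_add]

theorem FormalSeries.deriv_deriv_apply [CharZero K] (ξ η : FormalSeries K E E)
    (f : FormalSeries K E F) (s : ℕ) (x : E) :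
    (FormalSeries.deriv ξ (FormalSeries.deriv η f) s).1 x =
      (FormalSeries.deriv (FormalSeries.deriv ξ η) f s).1 x +
      ∑ p ∈ Finset.HasAntidiagonal.antidiagonal s, ∑ q ∈ Finset.HasAntidiagonal.antidiagonal p.2,
        polar₂ (f (q.2 + 2)) x ((ξ p.1).1 x) ((η q.1).1 x) := by
  have h1 : ∀ (k : ℕ) (v : E), polar (FormalSeries.deriv η f (k + 1)) x v =
      ∑ q ∈ Finset.HasAntidiagonal.antidiagonal k, polar₂ (f (q.2 + 2)) x v ((η q.1).1 x) +
      ∑ q ∈ Finset.HasAntidiagonal.antidiagonal k, polar (f (q.2 + 1)) x (polar (η (q.1 + 1)) x v) := by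
    intro k v
    have h2 : HasDer K (fun y => ∑ q ∈ Finset.HasAntidiagonal.antidiagonal (k + 1),
        polar (f (q.2 + 1)) y ((η q.1).1 y)) x v _ :=
      HasDer.sum _ fun q _ => hasDer_deriv (η q.1) (f (q.2 + 1)) x v
    have h3 := homPoly_hasDer (FormalSeries.deriv η f (k + 1)) x v
    have h4 : ((FormalSeries.deriv η f (k + 1)).1 : E → F) =
        fun y => ∑ q ∈ Finset.HasAntidiagonal.antidiagonal (k + 1), polar (f (q.2 + 1)) y ((η q.1).1 y) :=
      funext fun y => FormalSeries.deriv_apply η f (k + 1) y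
    rw [h4] at h3
    rw [h3.unique h2, Finset.sum_add_distrib]
    congr 1
    · rw [Finset.Nat.sum_antidiagonal_succ', polar₂_zero, zero_add]
    · rw [Finset.Nat.sum_antidiagonal_succ, polar_zero, ← polarLin_apply,
        map_zero, zero_add]
  rw [FormalSeries.deriv_apply, FormalSeries.deriv_apply]
  simp only [h1, Finset.sum_add_distrib]
  rw [add_comm]
  congr 1
  simp only [FormalSeries.deriv_apply, ← polarLin_apply, map_sum]
  rw [Finset.sum_sigma', Finset.sum_sigma']
  refine Finset.sum_nbij' (fun p => ⟨(p.1.1 + p.2.1, p.2.2), (p.1.1, p.2.1)⟩)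
    (fun p => ⟨(p.2.1, p.2.2 + p.1.2), (p.2.2, p.1.2)⟩) ?_ ?_ ?_ ?_ ?_
  · rintro ⟨⟨a, b⟩, ⟨c, d⟩⟩ h
    simp at h ⊢
    omega
  · rintro ⟨⟨a, b⟩, ⟨c, d⟩⟩ h
    simp at h ⊢
    omega
  · rintro ⟨⟨a, b⟩, ⟨c, d⟩⟩ h
    simp at h ⊢
    omega
  · rintro ⟨⟨a, b⟩, ⟨c, d⟩⟩ h
    simp at h ⊢
    omega
  · rintro ⟨⟨a, b⟩, ⟨c, d⟩⟩ h
    rfl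

end Derivation

section LieAlgebraOfFormalSeries

variable (K : Type*) [Field K] (X : Type*) [AddCommGroup X] [Module K X]

/-- `S(X) = X[[X]]`. -/
abbrev S : Type _ := FormalSeries K X X

variable [CharZero K]

/-- The product `ξ η` is the derivative of `η` along `ξ`. It makes `S(X)` a left pre-Lie algebra,
so that `[ξ, η] = ξ η - η ξ` is a Lie bracket. -/
noncomputable instance : LeftPreLieRing (S K X) where
  __ := (inferInstance : AddCommGroup (FormalSeries K X X))
  mul ξ η := FormalSeries.deriv ξ η
  left_distrib ξ η ζ := FormalSeries.ext fun s x => by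
    change (FormalSeries.deriv ξ (η + ζ) s).1 x =
      (FormalSeries.deriv ξ η s).1 x + (FormalSeries.deriv ξ ζ s).1 x
    simp only [FormalSeries.deriv_apply, ← Finset.sum_add_distrib]
    exact Finset.sum_congr rfl fun p _ => polar_add _ _ _ _
  right_distrib ξ η ζ := FormalSeries.ext fun s x => by
    change (FormalSeries.deriv (ξ + η) ζ s).1 x =
      (FormalSeries.deriv ξ ζ s).1 x + (FormalSeries.deriv η ζ s).1 x
    simp only [FormalSeries.deriv_apply, ← Finset.sum_add_distrib]
    exact Finset.sum_congr rfl fun p _ => map_add (polarLin (ζ (p.2 + 1)) x) _ _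
  zero_mul ξ := FormalSeries.ext fun s x => by
    change (FormalSeries.deriv 0 ξ s).1 x = 0
    rw [FormalSeries.deriv_apply]
    exact Finset.sum_eq_zero fun p _ => map_zero (polarLin (ξ (p.2 + 1)) x)
  mul_zero ξ := FormalSeries.ext fun s x => by
    change (FormalSeries.deriv ξ 0 s).1 x = 0
    rw [FormalSeries.deriv_apply]
    refine Finset.sum_eq_zero fun p _ => ?_
    have h := polar_smul (0 : K) (0 : HomPoly K X X (p.2 + 1)) x ((ξ p.1).1 x)
    rw [zero_smul, zero_smul] at h
    exact h
  assoc_symm' ξ η ζ := FormalSeries.ext fun s x => by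
    have h1 := FormalSeries.deriv_deriv_apply ξ η ζ s x
    have h2 := FormalSeries.deriv_deriv_apply η ξ ζ s x
    change (FormalSeries.deriv (FormalSeries.deriv ξ η) ζ s).1 x -
        (FormalSeries.deriv ξ (FormalSeries.deriv η ζ) s).1 x =
      (FormalSeries.deriv (FormalSeries.deriv η ξ) ζ s).1 x -
        (FormalSeries.deriv η (FormalSeries.deriv ξ ζ) s).1 x
    rw [h1, h2, sub_add_cancel_left, sub_add_cancel_left, neg_inj, Finset.sum_sigma',
      Finset.sum_sigma']
    refine Finset.sum_nbij' (fun p => ⟨(p.2.1, p.1.1 + p.2.2), (p.1.1, p.2.2)⟩)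
      (fun p => ⟨(p.2.1, p.1.1 + p.2.2), (p.1.1, p.2.2)⟩) ?_ ?_ ?_ ?_ ?_
    · rintro ⟨⟨a, b⟩, ⟨c, d⟩⟩ h
      simp at h ⊢
      omega
    · rintro ⟨⟨a, b⟩, ⟨c, d⟩⟩ h
      simp at h ⊢
      omega
    · rintro ⟨⟨a, b⟩, ⟨c, d⟩⟩ h
      simp at h ⊢
      omega
    · rintro ⟨⟨a, b⟩, ⟨c, d⟩⟩ h
      simp at h ⊢
      omega
    · rintro ⟨⟨a, b⟩, ⟨c, d⟩⟩ h
      exact polar₂_symm _ _ _ _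

noncomputable instance : LeftPreLieAlgebra K (S K X) where
  __ := (inferInstance : Module K (FormalSeries K X X))
  smul_assoc c ξ η := FormalSeries.ext fun s x => by
    change (FormalSeries.deriv (c • ξ) η s).1 x = c • (FormalSeries.deriv ξ η s).1 x
    simp only [FormalSeries.deriv_apply, Finset.smul_sum]
    exact Finset.sum_congr rfl fun p _ => map_smul (polarLin (η (p.2 + 1)) x) _ _
  smul_comm c ξ η := FormalSeries.ext fun s x => by
    change c • (FormalSeries.deriv ξ η s).1 x = (FormalSeries.deriv ξ (c • η) s).1 x
    simp only [FormalSeries.deriv_apply, Finset.smul_sum]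
    exact Finset.sum_congr rfl fun p _ => (polar_smul _ _ _ _).symm

theorem S.lie_eq (ξ η : S K X) :
    ⁅ξ, η⁆ = FormalSeries.deriv ξ η - FormalSeries.deriv η ξ := rfl

end LieAlgebraOfFormalSeries

/-- A formal (right) action of a Lie algebra `A` on the vector space `X` is a homomorphism of Lie
algebras `A → S(X)`. -/
abbrev FormalAction (K : Type*) [Field K] [CharZero K] (A : Type*) [LieRing A] [LieAlgebra K A]
    (X : Type*) [AddCommGroup X] [Module K X] : Type _ := A →ₗ⁅K⁆ S K X

section FundamentalAction

variable (K : Type*) [Field K]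

/-- The power series `G(T) = T e^T / (e^T - 1)`. Since `e^T - 1 = T ∑ T ^ n / (n + 1)!`, it is
`e^T` divided by the invertible series `∑ T ^ n / (n + 1)!`; see `genSeries_mul`. -/
noncomputable def genSeries [CharZero K] : PowerSeries K :=
  PowerSeries.exp K * (PowerSeries.mk fun n => ((n + 1).factorial : K)⁻¹)⁻¹

theorem genSeries_mul [CharZero K] :
    genSeries K * (PowerSeries.exp K - 1) = PowerSeries.X * PowerSeries.exp K := by
  have h1 : PowerSeries.exp K - 1 =
      PowerSeries.X * PowerSeries.mk fun n => ((n + 1).factorial : K)⁻¹ := by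
    ext n
    cases n with
    | zero => simp
    | succ n => simp [PowerSeries.coeff_succ_X_mul, PowerSeries.coeff_exp, PowerSeries.coeff_one]
  have h2 : (PowerSeries.mk fun n => ((n + 1).factorial : K)⁻¹)⁻¹ *
      (PowerSeries.mk fun n => ((n + 1).factorial : K)⁻¹) = 1 :=
    PowerSeries.inv_mul_cancel _ (by simp)
  rw [h1, genSeries, mul_left_comm, mul_assoc, h2, mul_one]

/-- The coefficient `t_n` of `T ^ n` in `G(T)`. -/
noncomputable def t [CharZero K] (n : ℕ) : K := PowerSeries.coeff n (genSeries K)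

variable {B : Type*} [LieRing B] [LieAlgebra K B]

theorem ad_pow_mem (b : B) (n : ℕ) :
    (fun y : B => ((LieAlgebra.ad K B y) ^ n) b) ∈ HomPoly K B B n := by
  induction n with
  | zero => exact ⟨MultilinearMap.constOfIsEmpty K _ b, fun y => by simp⟩
  | succ n ih =>
    have h : (fun y : B => y) ∈ HomPoly K B B 1 :=
      ⟨LinearMap.id.compMultilinearMap
        (MultilinearMap.ofSubsingleton K B B (0 : Fin 1) LinearMap.id), fun y => by simp⟩
    have := bilin_mem ((LieAlgebra.ad K B : B →ₗ[K] Module.End K B).flip) ih h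
    simpa [pow_succ'] using this

/-- The formal series `δ_b` with components `δ_{b,n}(y) = t_n (ad y)^n (b)`. The map `b ↦ δ_b` is
the fundamental action of `B`. -/
noncomputable def fundamental [CharZero K] (b : B) : S K B := fun n =>
  ⟨fun y => t K n • ((LieAlgebra.ad K B y) ^ n) b, (HomPoly K B B n).smul_mem _ (ad_pow_mem K b n)⟩

end FundamentalAction

end FormalAct

/-! Everything reduces to an identity between polynomials in two commuting variables. Encode `[(ad
y)^p a, (ad y)^q b]` as `X₀^p X₁^q`. By the Jacobi identity `ad y` is a derivation, so it acts on
such brackets as multiplication by `X₀ + X₁`; in particular `(ad y)^s [a, b]` is encoded by `(X₀ +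
X₁)^s`.

Differentiating `(ad y)^n b` at `x` in the direction `(ad x)^r a` replaces one factor `ad x` at a
time by `ad ((ad x)^r a)`. The result is encoded by `X₀^r ((X₀ + X₁)^n - X₁^n) / X₀`
(`hasDer_ad_pow`). Exchanging `a` and `b` swaps the variables and changes the sign, so the
commutator of the two series becomes a sum symmetric in `X₀` and `X₁`.

It remains to see that this sum, weighted by `t_r t_n` over `r + n - 1 = s`, equals `t_s (X₀ +
X₁)^s` (`sum_divDiff`). This is the coefficient of `Z^(s+1)` in the functional equation
`genSeriesAt_functional` of `G`, which is the addition formula for `a / (a - 1)` at `a = e^(xZ)`. -/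

namespace FormalAct

open Finset

/-! ### Divided differences of powers -/

section DividedDifference

variable {R : Type*} [CommRing R]

/-- The divided difference `((x + y) ^ n - y ^ n) / x`. -/
def divDiff (x y : R) : ℕ → R
  | 0 => 0
  | n + 1 => y ^ n + (x + y) * divDiff x y n

/-- The recursion for `divDiff` follows the product rule for `(ad y)^(n+1) b`; the closed form
obtained here is the one that meets the generating series. -/
theorem mul_divDiff (x y : R) (n : ℕ) : x * divDiff x y n = (x + y) ^ n - y ^ n := by
  induction n with
  | zero => simp [divDiff]
  | succ n ih =>
    rw [divDiff, mul_add, mul_left_comm, ih]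
    ring

end DividedDifference

/-! ### The functional equation of `G` and its coefficients -/

section GeneratingSeries

variable {K : Type*} [Field K] [CharZero K] {R : Type*} [CommRing R] [Algebra K R]

variable (K) in
/-- The series `G(x Z)` in the variable `Z`. -/
noncomputable def genSeriesAt (x : R) : PowerSeries R :=
  PowerSeries.rescale x (PowerSeries.map (algebraMap K R) (genSeries K))

theorem coeff_genSeriesAt (x : R) (n : ℕ) :
    PowerSeries.coeff n (genSeriesAt K x) = t K n • x ^ n := by
  rw [genSeriesAt, PowerSeries.coeff_rescale, PowerSeries.coeff_map, Algebra.smul_def, mul_comm, t]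

variable [Algebra ℚ R]

theorem genSeriesAt_mul (x : R) :
    genSeriesAt K x * (PowerSeries.rescale x (PowerSeries.exp R) - 1) =
      PowerSeries.C x * PowerSeries.X * PowerSeries.rescale x (PowerSeries.exp R) := by
  have h := congrArg (fun p => PowerSeries.rescale x (PowerSeries.map (algebraMap K R) p))
    (genSeries_mul K)
  simpa [genSeriesAt, PowerSeries.map_exp, PowerSeries.rescale_X] using h

/-- The coefficient of `Z` is `x`. In a domain the denominators of `G` can therefore be cancelled.
-/
theorem rescale_exp_sub_one_ne_zero {x : R} (hx : x ≠ 0) :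
    PowerSeries.rescale x (PowerSeries.exp R) - 1 ≠ 0 := by
  intro h
  have := congrArg (PowerSeries.coeff 1) h
  simp [PowerSeries.coeff_rescale, PowerSeries.coeff_exp, PowerSeries.coeff_one] at this
  exact hx this

/-- The functional equation of the series `G`. -/
theorem genSeriesAt_functional [IsDomain R] {x y : R} (hx : x ≠ 0) (hy : y ≠ 0)
    (hxy : x + y ≠ 0) :
    PowerSeries.C y * genSeriesAt K x * (genSeriesAt K (x + y) - genSeriesAt K y) +
      PowerSeries.C x * genSeriesAt K y * (genSeriesAt K (x + y) - genSeriesAt K x) =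
    PowerSeries.C (x * y) * (PowerSeries.X * genSeriesAt K (x + y)) := by
  have ha := rescale_exp_sub_one_ne_zero hx
  have hb := rescale_exp_sub_one_ne_zero hy
  have hc := rescale_exp_sub_one_ne_zero hxy
  have hA := genSeriesAt_mul (K := K) x
  have hB := genSeriesAt_mul (K := K) y
  have hC := genSeriesAt_mul (K := K) (x + y)
  have hexp := PowerSeries.exp_mul_exp_eq_exp_add x y
  rw [← hexp] at hc hC
  rw [map_add] at hC
  rw [map_mul]
  set a := PowerSeries.rescale x (PowerSeries.exp R)
  set b := PowerSeries.rescale y (PowerSeries.exp R)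
  set A := genSeriesAt K x
  set B := genSeriesAt K y
  set C := genSeriesAt K (x + y)
  set X := PowerSeries.C x
  set Y := PowerSeries.C y
  set Z := (PowerSeries.X : PowerSeries R)
  -- Clear the denominators `a - 1`, `b - 1`, `ab - 1`, where `ab = e^((x+y)Z)`. With `g(a) = a / (a
  -- - 1)`, the claim comes down to `g(ab) (g(a) + g(b) - 1) = g(a) g(b)`, which holds because `a(b
  -- - 1) + b(a - 1) - (a - 1)(b - 1) = ab - 1`.
  refine mul_right_cancel₀ (mul_ne_zero (mul_ne_zero ha hb) hc) ?_
  linear_combination (Y * (b - 1) * (a * b - 1) * (C - B) - X * B * (b - 1) * (a * b - 1)) * hA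
    + (X * (a - 1) * (a * b - 1) * C - (X + Y) * X * Z * a * (a * b - 1)) * hB
    + (X * Y * Z * a * (b - 1) + X * Y * Z * b * (a - 1) - X * Y * Z * (a - 1) * (b - 1)) * hC

/-- Compare coefficients of `Z^(s+1)` in the functional equation and cancel `xy`, which turns the
differences of powers into divided differences. -/
theorem sum_divDiff [IsDomain R] {x y : R} (hx : x ≠ 0) (hy : y ≠ 0) (hxy : x + y ≠ 0) (s : ℕ) :
    ∑ p ∈ antidiagonal s, (t K p.1 * t K (p.2 + 1)) •
      (x ^ p.1 * divDiff x y (p.2 + 1) + y ^ p.1 * divDiff y x (p.2 + 1)) =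
    t K s • (x + y) ^ s := by
  have h := congrArg (PowerSeries.coeff (s + 1)) (genSeriesAt_functional (K := K) hx hy hxy)
  rw [map_add, mul_assoc, mul_assoc, PowerSeries.coeff_C_mul, PowerSeries.coeff_C_mul,
    PowerSeries.coeff_C_mul, PowerSeries.coeff_succ_X_mul, PowerSeries.coeff_mul,
    PowerSeries.coeff_mul, Finset.Nat.sum_antidiagonal_succ', Finset.Nat.sum_antidiagonal_succ']
    at h
  -- The terms split off from the antidiagonals carry the constant coefficient of a difference of
  -- two values of `G`, which vanishes; this produces the shift to `p.2 + 1`.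
  simp only [map_sub, coeff_genSeriesAt, pow_zero, sub_self, mul_zero, zero_add] at h
  refine mul_left_cancel₀ (mul_ne_zero hx hy) ?_
  rw [← h, Finset.mul_sum, Finset.mul_sum, Finset.mul_sum, ← Finset.sum_add_distrib]
  refine Finset.sum_congr rfl fun p _ => ?_
  have h1 := mul_divDiff x y (p.2 + 1)
  have h2 := mul_divDiff y x (p.2 + 1)
  rw [add_comm y x] at h2
  simp only [Algebra.smul_def, map_mul]
  linear_combination (algebraMap K R (t K p.1) * algebraMap K R (t K (p.2 + 1))) *
    (y * x ^ p.1 * h1 + x * y ^ p.1 * h2)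

end GeneratingSeries

/-! ### Brackets of iterated adjoints as polynomials -/

section Bracket

variable {K : Type*} [Field K] {B : Type*} [LieRing B] [LieAlgebra K B]

open MvPolynomial

/-- The linear map with `X₀ ^ p * X₁ ^ q ↦ [(ad y) ^ p a, (ad y) ^ q b]`. -/
noncomputable def bracketEval (y a b : B) : MvPolynomial (Fin 2) K →ₗ[K] B :=
  (basisMonomials (Fin 2) K).constr K fun m =>
    ⁅((LieAlgebra.ad K B y) ^ m 0) a, ((LieAlgebra.ad K B y) ^ m 1) b⁆

theorem bracketEval_monomial (y a b : B) (m : Fin 2 →₀ ℕ) :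
    bracketEval y a b (monomial m (1 : K)) =
      ⁅((LieAlgebra.ad K B y) ^ m 0) a, ((LieAlgebra.ad K B y) ^ m 1) b⁆ := by
  have h := (basisMonomials (Fin 2) K).constr_basis K (fun m =>
    ⁅((LieAlgebra.ad K B y) ^ m 0) a, ((LieAlgebra.ad K B y) ^ m 1) b⁆) m
  rwa [coe_basisMonomials] at h

theorem bracketEval_pow_mul_pow (y a b : B) (p q : ℕ) :
    bracketEval y a b (X 0 ^ p * X 1 ^ q : MvPolynomial (Fin 2) K) =
      ⁅((LieAlgebra.ad K B y) ^ p) a, ((LieAlgebra.ad K B y) ^ q) b⁆ := by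
  rw [X_pow_eq_monomial, X_pow_eq_monomial, monomial_mul, one_mul, bracketEval_monomial]
  simp

/-- On monomials this is the Leibniz rule for `ad y`. -/
theorem bracketEval_add_mul (y a b : B) (f : MvPolynomial (Fin 2) K) :
    bracketEval y a b ((X 0 + X 1) * f) = ⁅y, bracketEval y a b f⁆ := by
  suffices h : bracketEval y a b ∘ₗ LinearMap.mulLeft K (X 0 + X 1) =
      (LieAlgebra.ad K B y : B →ₗ[K] B) ∘ₗ bracketEval y a b from LinearMap.congr_fun h f
  refine (basisMonomials (Fin 2) K).ext fun m => ?_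
  simp only [coe_basisMonomials, LinearMap.comp_apply, LinearMap.mulLeft_apply, add_mul, map_add,
    X, monomial_mul, one_mul, bracketEval_monomial, LieAlgebra.ad_apply]
  rw [leibniz_lie]
  simp [add_comm 1, pow_succ']

theorem bracketEval_add_pow (y a b : B) (n : ℕ) :
    bracketEval y a b ((X 0 + X 1) ^ n : MvPolynomial (Fin 2) K) =
      ((LieAlgebra.ad K B y) ^ n) ⁅a, b⁆ := by
  induction n with
  | zero => simpa using bracketEval_pow_mul_pow (K := K) y a b 0 0
  | succ n ih => rw [pow_succ', bracketEval_add_mul, ih, pow_succ']; rfl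

theorem hasDer_id (x v : B) : HasDer K (fun y : B => y) x v v :=
  ⟨0, (PolyFun K B).zero_mem, fun s => by simp⟩

/-- Induction with the product rule for `[y, (ad y)^n b]`: varying the outer `y` gives `X₀^r X₁^n`,
and varying the inner factor multiplies the previous derivative by `X₀ + X₁`. These are the two
terms in the recursion for `divDiff`. -/
theorem hasDer_ad_pow (x a b : B) (r n : ℕ) :
    HasDer K (fun y => ((LieAlgebra.ad K B y) ^ n) b) x (((LieAlgebra.ad K B x) ^ r) a)
      (bracketEval x a b (X 0 ^ r * divDiff (X 0) (X 1) n : MvPolynomial (Fin 2) K)) := by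
  induction n with
  | zero =>
    refine ⟨0, (PolyFun K B).zero_mem, fun s => ?_⟩
    simp [divDiff]
  | succ n ih =>
    have h := HasDer.bilin (LieAlgebra.ad K B : B →ₗ[K] Module.End K B) (hasDer_id x _) ih
    rw [divDiff, mul_add, map_add, bracketEval_pow_mul_pow, mul_left_comm, bracketEval_add_mul]
    simpa [pow_succ'] using h

/-- Antisymmetry of the bracket, checked on monomials. -/
theorem bracketEval_swap (x a b : B) (f : MvPolynomial (Fin 2) K) :
    bracketEval x b a (rename (Equiv.swap 0 1) f) = -bracketEval x a b f := by
  suffices h : bracketEval x b a ∘ₗ (rename (Equiv.swap 0 1)).toLinearMap =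
      -bracketEval (K := K) x a b from LinearMap.congr_fun h f
  refine (basisMonomials (Fin 2) K).ext fun m => ?_
  have h0 := Finsupp.mapDomain_equiv_apply (f := Equiv.swap (0 : Fin 2) 1) m 0
  have h1 := Finsupp.mapDomain_equiv_apply (f := Equiv.swap (0 : Fin 2) 1) m 1
  simp only [Equiv.symm_swap, Equiv.swap_apply_left, Equiv.swap_apply_right] at h0 h1
  simp only [coe_basisMonomials, LinearMap.comp_apply, AlgHom.toLinearMap_apply, rename_monomial,
    bracketEval_monomial, h0, h1, LinearMap.neg_apply, lie_skew]

theorem map_divDiff {R S : Type*} [CommRing R] [CommRing S] (φ : R →+* S) (x y : R) (n : ℕ) :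
    φ (divDiff x y n) = divDiff (φ x) (φ y) n := by
  induction n with
  | zero => simp [divDiff]
  | succ n ih => simp [divDiff, ih]

theorem bracketEval_divDiff_swap (x a b : B) (r n : ℕ) :
    bracketEval x b a (X 0 ^ r * divDiff (X 0) (X 1) n : MvPolynomial (Fin 2) K) =
      -bracketEval x a b (X 1 ^ r * divDiff (X 1) (X 0) n : MvPolynomial (Fin 2) K) := by
  rw [← bracketEval_swap]
  have h := map_divDiff ((rename (Equiv.swap (0 : Fin 2) 1)).toRingHom :
    MvPolynomial (Fin 2) K →+* MvPolynomial (Fin 2) K) (X 1) (X 0) n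
  simp only [AlgHom.toRingHom_eq_coe, RingHom.coe_coe, rename_X, Equiv.swap_apply_left,
    Equiv.swap_apply_right] at h
  simp [h]

end Bracket

/-! ### The fundamental action is a homomorphism -/

section FundamentalAction

variable {K : Type*} [Field K] [CharZero K] {B : Type*} [LieRing B] [LieAlgebra K B]

open MvPolynomial

theorem polar_fundamental (x a b : B) (r n : ℕ) :
    polar (fundamental K b n) x ((fundamental K a r).1 x) = (t K r * t K n) •
      bracketEval x a b (X 0 ^ r * divDiff (X 0) (X 1) n : MvPolynomial (Fin 2) K) := by
  have h1 : polar (⟨_, ad_pow_mem K b n⟩ : HomPoly K B B n) x (((LieAlgebra.ad K B x) ^ r) a) =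
      bracketEval x a b (X 0 ^ r * divDiff (X 0) (X 1) n : MvPolynomial (Fin 2) K) :=
    -- In characteristic zero the linear coefficient along a line is unique, so it may be computed
    -- by the product rule instead of from a determining multilinear map.
    (homPoly_hasDer _ x _).unique (hasDer_ad_pow x a b r n)
  have h2 : fundamental K b n = t K n • (⟨_, ad_pow_mem K b n⟩ : HomPoly K B B n) := rfl
  have h3 : (fundamental K a r).1 x = t K r • ((LieAlgebra.ad K B x) ^ r) a := rfl
  rw [h2, h3, polar_smul, ← polarLin_apply, map_smul, polarLin_apply, h1, smul_smul, mul_comm]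

theorem fundamental_lie (a b : B) :
    fundamental K ⁅a, b⁆ = ⁅fundamental K a, fundamental K b⁆ := by
  rw [S.lie_eq]
  refine FormalSeries.ext fun s x => ?_
  change t K s • ((LieAlgebra.ad K B x) ^ s) ⁅a, b⁆ =
    (FormalSeries.deriv (fundamental K a) (fundamental K b) s).1 x -
      (FormalSeries.deriv (fundamental K b) (fundamental K a) s).1 x
  -- Evaluation at the point `(1, 0)` gives `1`.
  have h01 : (X 0 + X 1 : MvPolynomial (Fin 2) K) ≠ 0 := fun h => by
    simpa using congrArg (MvPolynomial.eval (Pi.single (0 : Fin 2) (1 : K))) h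
  have h := congrArg (bracketEval x a b)
    (sum_divDiff (K := K) (X_ne_zero (0 : Fin 2)) (X_ne_zero 1) h01 s)
  rw [map_smul, bracketEval_add_pow, map_sum] at h
  rw [← h, FormalSeries.deriv_apply, FormalSeries.deriv_apply, ← Finset.sum_sub_distrib]
  refine Finset.sum_congr rfl fun p _ => ?_
  -- The sign from exchanging `a` and `b` turns the difference of the two derivatives into the
  -- symmetric sum of `sum_divDiff`, term by term.
  rw [polar_fundamental, polar_fundamental, bracketEval_divDiff_swap x a b, map_smul, map_add, smul_add,
    smul_neg, sub_neg_eq_add]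

/-- The fundamental action of a Lie algebra on itself. -/
noncomputable def fundamentalAction (K : Type*) [Field K] [CharZero K] (B : Type*) [LieRing B]
    [LieAlgebra K B] : FormalAction K B B where
  toFun := fundamental K
  map_add' a b := FormalSeries.ext fun n y => by
    change t K n • ((LieAlgebra.ad K B y) ^ n) (a + b) =
      t K n • ((LieAlgebra.ad K B y) ^ n) a + t K n • ((LieAlgebra.ad K B y) ^ n) b
    rw [map_add, smul_add]
  map_smul' c a := FormalSeries.ext fun n y => by
    change t K n • ((LieAlgebra.ad K B y) ^ n) (c • a) =
      c • t K n • ((LieAlgebra.ad K B y) ^ n) a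
    rw [map_smul, smul_comm]
  map_lie' := fundamental_lie _ _

end FundamentalAction

end FormalAct

theorem mainTheorem2 (K : Type*) [Field K] [CharZero K] (B : Type*) [LieRing B] [LieAlgebra K B] :
    ∃ δ : FormalAct.FormalAction K B B, ∀ b : B, δ b = FormalAct.fundamental K b :=
  ⟨FormalAct.fundamentalAction K B, fun _ => rfl⟩
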